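/- Let $\sigma$ be the Fibonacci morphism on words over $\{a,b\}$, $\sigma(a)=ab$, $\sigma(b)=a$, let $\mathbb F=abaababa\cdots$ be its infinite fixed point beginning with $a$, and for $m\ge 0$ let $F_m=\sigma^m(a)$ and let $f_m$ be the Fibonacci numbers with $f_0=1$, $f_1=2$, $f_{m+2}=f_{m+1}+f_m$. For $n\ge1$ let $A(n)$ be the number of occurrences of nonempty palindromes in $\mathbb F$ that end at position $n$ (i.e. the number of nonempty palindromic suffixes of the prefix of $\mathbb F$ of length $n$), and let $B(n)=\sum_{i=1}^{n}A(i)$. Then, for every integer $m\ge 0$, $F_m$ is the prefix of $\mathbb F$ of length $f_m$, and the number of occurrences of nonempty palindromes in $F_m$, counted with repetition (i.e. the number of pairs $1\le i\le j\le f_m$ such that the factor $x_i\cdots x_j$ of $F_m=x_1\cdots x_{f_m}$ is a palindrome), is $$B(f_m)=\frac{m-3}{5}\,f_{m+2}+\frac{m-1}{5}\,f_m+m+3 .$$ -/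

import Mathlib

namespace FibPal

/-- The binary alphabet `{a, b}`. -/
inductive Letter where
  | a : Letter
  | b : Letter
  deriving DecidableEq

/-- Finite words over `{a, b}`; concatenation is `++`. -/
abbrev Word := List Letter

/-- The images of the letters under the Fibonacci morphism: `a ↦ ab`, `b ↦ a`. -/
def sigmaLetter : Letter → Word
  | Letter.a => [Letter.a, Letter.b]
  | Letter.b => [Letter.a]

/-- The Fibonacci morphism on words. -/
def sigma (w : Word) : Word := w.flatMap sigmaLetter

/-- The word `F_m = σ^m(a)`, for `m ≥ 0`. -/
def F (m : ℕ) : Word := sigma^[m] [Letter.a]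

/-- The numbers `f_m`, `m ≥ 0`, given by `f_0 = 1`, `f_1 = 2`, `f_{m+2} = f_{m+1} + f_m`. -/
def f : ℕ → ℕ
  | 0 => 1
  | 1 => 2
  | m + 2 => f (m + 1) + f m

/-- The (infinite) Fibonacci sequence. The letters are numbered from `0` here, so `fibSeq n` is the
letter in position `n + 1`; it is read off from `F_n`, which has more than `n` letters, so that the
default value is never used. See `sigma_pre` for the fixed point property. -/
def fibSeq (n : ℕ) : Letter := (F n).getD n Letter.a

/-- The prefix of length `n` of the Fibonacci sequence. -/
def pre (n : ℕ) : Word := (List.range n).map fibSeq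

/-- The factor `x_i x_{i+1} ⋯ x_j` of the word `w = x_1 ⋯ x_n`, for `1 ≤ i ≤ j ≤ n`. -/
def factor (w : Word) (i j : ℕ) : Word := (w.drop (i - 1)).take (j + 1 - i)

/-- A word is a palindrome if it equals its mirror word. -/
def IsPal (w : Word) : Prop := w.reverse = w

instance (w : Word) : Decidable (IsPal w) := inferInstanceAs (Decidable (w.reverse = w))

/-- The number of occurrences of nonempty palindromes in the word `w`, counted with repetition:
the number of pairs of positions `1 ≤ i ≤ j ≤ |w|` such that `x_i ⋯ x_j` is a palindrome. -/
def palOccurrences (w : Word) : ℕ :=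
  ((Finset.Icc 1 w.length ×ˢ Finset.Icc 1 w.length).filter
    (fun p => p.1 ≤ p.2 ∧ IsPal (factor w p.1 p.2))).card

/-- `A n` is the number of occurrences of nonempty palindromes in the Fibonacci sequence that end
at position `n`, that is, of nonempty palindromic suffixes of its prefix of length `n`. -/
def A (n : ℕ) : ℕ := ((Finset.Icc 1 n).filter (fun i => IsPal (factor (pre n) i n))).card

/-- `B n = A 1 + ⋯ + A n`. -/
def B (n : ℕ) : ℕ := ∑ i ∈ Finset.Icc 1 n, A i

theorem sigma_append (u v : Word) : sigma (u ++ v) = sigma u ++ sigma v := by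
  simp [sigma]

theorem F_succ (m : ℕ) : F (m + 1) = sigma (F m) := by
  simp only [F, Function.iterate_succ_apply']

theorem F_add_two (m : ℕ) : F (m + 2) = F (m + 1) ++ F m := by
  induction m with
  | zero => rfl
  | succ k ih => rw [F_succ (k + 2), ih, sigma_append, ← F_succ, ← F_succ, ← ih]

theorem lt_length_F (m : ℕ) : m < (F m).length := by
  induction m using Nat.twoStepInduction with
  | zero => decide
  | one => decide
  | more k h1 h2 => rw [F_add_two, List.length_append]; omega

theorem F_prefix_succ (m : ℕ) : F m <+: F (m + 1) := by
  cases m with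
  | zero => exact ⟨[Letter.b], rfl⟩
  | succ k => exact ⟨F k, (F_add_two k).symm⟩

theorem F_prefix {m n : ℕ} (h : m ≤ n) : F m <+: F n := by
  induction h with
  | refl => exact List.prefix_rfl
  | step _ ih => exact ih.trans (F_prefix_succ _)

theorem pre_eq_take {n k : ℕ} (h : n ≤ (F k).length) : pre n = (F k).take n := by
  apply List.ext_getElem
  · simp [pre, h]
  · intro i h1 h2
    have hi : i < n := by simpa [pre] using h1
    have hF : (F i)[i]'(lt_length_F i) = (F k)[i]'(by omega) := by
      rcases le_total i k with hk | hk
      · exact (F_prefix hk).getElem _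
      · exact ((F_prefix hk).getElem _).symm
    have hD : fibSeq i = (F i)[i]'(lt_length_F i) := List.getD_eq_getElem _ _ (lt_length_F i)
    simp [pre, hD, hF]

/-- The Fibonacci sequence begins with `a`. -/
theorem fibSeq_zero : fibSeq 0 = Letter.a := rfl

/-- The Fibonacci sequence is fixed by `σ`: the image of each prefix is again a prefix. -/
theorem sigma_pre (n : ℕ) : sigma (pre n) = pre (sigma (pre n)).length := by
  have h1 : pre n <+: F n := by
    rw [pre_eq_take (lt_length_F n).le]; exact List.take_prefix _ _
  have h2 : sigma (pre n) <+: F (n + 1) := by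
    obtain ⟨t, ht⟩ := h1
    exact ⟨sigma t, by rw [F_succ, ← ht, sigma_append]⟩
  rw [pre_eq_take h2.length_le]
  exact List.prefix_iff_eq_take.mp h2

end FibPal

namespace FibPal

/-! Palindromes desubstitute: `w` is a palindrome iff `σ(w)a` is (`palOn_sigmaLen`). A palindrome
occurrence starting and ending with `a` is `σ(w)a` for a unique palindromic occurrence `w`, possibly
empty; one starting and ending with `b` becomes such a word once the neighbouring `a`s are added.

Hence `A` at a position of `σ(x)` is governed by `A` at its preimage. Summing separately over final
`a` and final `b` expresses `B (f (m + 2))` through `B (f (m + 1))`, `B (f m)` and the boundary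
terms `A (f (m + 1))`, `A (f m)`. These are known from `A_f`, and the closed form solves the
resulting recurrence. -/

/-- The length of the image under `σ` of the prefix of length `n`. -/
def sigmaLen (n : ℕ) : ℕ := (sigma (pre n)).length

theorem pre_succ (n : ℕ) : pre (n + 1) = pre n ++ [fibSeq n] := by
  simp [pre, List.range_succ]

theorem length_pre (n : ℕ) : (pre n).length = n := by simp [pre]

theorem getElem?_pre {n i : ℕ} (h : i < n) : (pre n)[i]? = some (fibSeq i) := by
  simp [pre, h]

theorem sigma_pre_succ (n : ℕ) :
    sigma (pre (n + 1)) = sigma (pre n) ++ sigmaLetter (fibSeq n) := by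
  rw [pre_succ, sigma_append]; simp [sigma]

theorem sigmaLen_succ_of_a {n : ℕ} (h : fibSeq n = Letter.a) :
    sigmaLen (n + 1) = sigmaLen n + 2 := by
  simp [sigmaLen, sigma_pre_succ, h, sigmaLetter]

theorem sigmaLen_succ_of_b {n : ℕ} (h : fibSeq n = Letter.b) :
    sigmaLen (n + 1) = sigmaLen n + 1 := by
  simp [sigmaLen, sigma_pre_succ, h, sigmaLetter]

theorem Letter.eq_a_or_eq_b (l : Letter) : l = Letter.a ∨ l = Letter.b := by
  cases l <;> simp

theorem fibSeq_sigmaLen_add (n k : ℕ) (h : k < (sigmaLetter (fibSeq n)).length) :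
    some (fibSeq (sigmaLen n + k)) = (sigmaLetter (fibSeq n))[k]? := by
  have h1 := sigma_pre (n + 1)
  have hl : (sigma (pre (n + 1))).length =
      sigmaLen n + (sigmaLetter (fibSeq n)).length := by
    rw [sigma_pre_succ, List.length_append]; rfl
  rw [← getElem?_pre (n := (sigma (pre (n + 1))).length) (by omega), ← h1, sigma_pre_succ,
    List.getElem?_append_right (by simp [sigmaLen])]
  simp [sigmaLen]

theorem fibSeq_sigmaLen (n : ℕ) : fibSeq (sigmaLen n) = Letter.a := by
  have h := fibSeq_sigmaLen_add n 0
  rcases Letter.eq_a_or_eq_b (fibSeq n) with hn | hn <;> simpa [hn, sigmaLetter] using h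

theorem fibSeq_sigmaLen_add_one {n : ℕ} (hn : fibSeq n = Letter.a) :
    fibSeq (sigmaLen n + 1) = Letter.b := by
  have h := fibSeq_sigmaLen_add n 1
  simpa [hn, sigmaLetter] using h

theorem sigmaLen_strictMono : StrictMono sigmaLen := by
  refine strictMono_nat_of_lt_succ fun n => ?_
  rcases Letter.eq_a_or_eq_b (fibSeq n) with hn | hn
  · rw [sigmaLen_succ_of_a hn]; omega
  · rw [sigmaLen_succ_of_b hn]; omega

/-- Every position is the first or the second letter of the image of a letter. -/
theorem exists_eq_sigmaLen (k : ℕ) :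
    (∃ n, k = sigmaLen n) ∨ ∃ n, fibSeq n = Letter.a ∧ k = sigmaLen n + 1 := by
  induction k with
  | zero => exact Or.inl ⟨0, rfl⟩
  | succ k ih =>
    rcases ih with ⟨n, rfl⟩ | ⟨n, hn, rfl⟩
    · rcases Letter.eq_a_or_eq_b (fibSeq n) with hn | hn
      · exact Or.inr ⟨n, hn, rfl⟩
      · exact Or.inl ⟨n + 1, (sigmaLen_succ_of_b hn).symm⟩
    · exact Or.inl ⟨n + 1, (sigmaLen_succ_of_a hn).symm⟩

/-! ### Palindromes under the morphism -/

/-- The letters in the (0-based) positions `i ≤ k < j` form a palindrome. -/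
def PalOn (i j : ℕ) : Prop :=
  ∀ k l, i ≤ k → i ≤ l → k + l + 1 = i + j → fibSeq k = fibSeq l

theorem palOn_self (i : ℕ) : PalOn i i := by
  intro k l hk hl h; omega

theorem palOn_succ {i j : ℕ} (hij : i ≤ j) :
    PalOn i (j + 1) ↔ fibSeq i = fibSeq j ∧ PalOn (i + 1) j := by
  constructor
  · intro h
    exact ⟨h i j le_rfl hij (by omega), fun k l hk hl hkl => h k l (by omega) (by omega) (by omega)⟩
  · rintro ⟨h0, h⟩ k l hk hl hkl
    rcases Nat.eq_or_lt_of_le hk with rfl | hk'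
    · obtain rfl : l = j := by omega
      exact h0
    · rcases Nat.eq_or_lt_of_le hl with rfl | hl'
      · obtain rfl : k = j := by omega
        exact h0.symm
      · exact h k l hk' hl' (by omega)

theorem palOn_succ_self (i : ℕ) : PalOn i (i + 1) :=
  (palOn_succ le_rfl).2 ⟨rfl, fun k l hk hl h => by omega⟩

/-- `w` is a palindrome if and only if `σ(w)a` is one. -/
theorem palOn_sigmaLen (d i : ℕ) :
    PalOn (sigmaLen i) (sigmaLen (i + d) + 1) ↔ PalOn i (i + d) := by
  induction d using Nat.twoStepInduction generalizing i with
  | zero => exact iff_of_true (palOn_succ_self _) (palOn_self _)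
  | one =>
    refine iff_of_true ?_ (palOn_succ_self _)
    rw [palOn_succ (sigmaLen_strictMono.monotone (by omega)), fibSeq_sigmaLen, fibSeq_sigmaLen]
    refine ⟨rfl, ?_⟩
    rcases Letter.eq_a_or_eq_b (fibSeq i) with hi | hi
    · rw [sigmaLen_succ_of_a hi]; exact palOn_succ_self _
    · rw [sigmaLen_succ_of_b hi]; exact palOn_self _
  | more d ih _ =>
    have ih := ih (i + 1)
    have hlt : sigmaLen (i + 1) ≤ sigmaLen (i + 1 + d) := sigmaLen_strictMono.monotone (by omega)
    have hlt' : sigmaLen i < sigmaLen (i + 1) := sigmaLen_strictMono (by omega)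
    have e : i + (d + 2) = i + 1 + d + 1 := by omega
    rw [e, palOn_succ (i := i) (by omega),
      palOn_succ (sigmaLen_strictMono.monotone (by omega)), fibSeq_sigmaLen, fibSeq_sigmaLen, ← ih]
    -- Equal outer letters reduce to the inner word. If they differ, the second letters of `σ(w)a`
    -- from its two ends are `a` and `b`, so neither side holds.
    rcases Letter.eq_a_or_eq_b (fibSeq i) with hi | hi <;>
      rcases Letter.eq_a_or_eq_b (fibSeq (i + 1 + d)) with hj | hj
    · rw [sigmaLen_succ_of_a hj, sigmaLen_succ_of_a hi,
        palOn_succ (by rw [sigmaLen_succ_of_a hi] at hlt; omega), fibSeq_sigmaLen_add_one hi,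
        fibSeq_sigmaLen_add_one hj]
      simp [hi, hj]
    · rw [sigmaLen_succ_of_b hj, palOn_succ (by omega), fibSeq_sigmaLen_add_one hi,
        fibSeq_sigmaLen]
      simp [hi, hj]
    · rw [sigmaLen_succ_of_a hj, palOn_succ (by omega), fibSeq_sigmaLen_add_one hj,
        ← sigmaLen_succ_of_b hi, fibSeq_sigmaLen]
      simp [hi, hj]
    · rw [sigmaLen_succ_of_b hj, sigmaLen_succ_of_b hi]
      simp [hi, hj]

theorem palOn_sigmaLen_of_le {i j : ℕ} (h : i ≤ j) :
    PalOn (sigmaLen i) (sigmaLen j + 1) ↔ PalOn i j := by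
  obtain ⟨d, rfl⟩ := Nat.exists_eq_add_of_le h
  exact palOn_sigmaLen d i

theorem getElem?_factor_pre {N i j : ℕ} (hj : j ≤ N) (hi : 1 ≤ i) (k : ℕ) :
    (factor (pre N) i j)[k]? = if k < j + 1 - i then some (fibSeq (i - 1 + k)) else none := by
  unfold factor
  rw [List.getElem?_take]
  split_ifs with h
  · rw [List.getElem?_drop, getElem?_pre (by omega)]
  · rfl

theorem factor_pre {N i j : ℕ} (hj : j ≤ N) (hi : 1 ≤ i) :
    factor (pre N) i j = factor (pre j) i j := by
  apply List.ext_getElem?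
  intro k
  rw [getElem?_factor_pre hj hi, getElem?_factor_pre le_rfl hi]

theorem isPal_factor {i n : ℕ} (hi : i < n) :
    IsPal (factor (pre n) (i + 1) n) ↔ PalOn i n := by
  have hg := fun k => getElem?_factor_pre (N := n) (i := i + 1) (j := n) le_rfl (by omega) k
  have hl : (factor (pre n) (i + 1) n).length = n - i := by
    simp [factor, length_pre]
  unfold IsPal
  constructor
  · intro h k l hk hl' hkl
    have := hg (k - i)
    rw [← h, List.getElem?_reverse (by omega), hg, if_pos (by omega), if_pos (by omega)] at this
    have := Option.some.inj this
    rw [show i + 1 - 1 + (k - i) = k by omega, hl,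
      show i + 1 - 1 + (n - i - 1 - (k - i)) = l by omega] at this
    exact this.symm
  · intro h
    apply List.ext_getElem?
    intro k
    by_cases hk : k < n - i
    · rw [List.getElem?_reverse (by omega), hg, hg, if_pos (by omega), if_pos (by omega)]
      exact congrArg _ (h _ _ (by omega) (by omega) (by omega))
    · rw [List.getElem?_eq_none (by simp; omega), List.getElem?_eq_none (by omega)]

open Classical in
theorem A_eq_card (n : ℕ) : A n = ((Finset.range n).filter (fun i => PalOn i n)).card := by
  symm
  refine Finset.card_bij (fun i _ => i + 1) ?_ ?_ ?_
  · intro i hi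
    simp only [Finset.mem_filter, Finset.mem_range, Finset.mem_Icc] at hi ⊢
    exact ⟨by omega, (isPal_factor hi.1).2 hi.2⟩
  · intro i _ j _ h; simpa using h
  · intro i hi
    simp only [Finset.mem_filter, Finset.mem_Icc] at hi
    obtain ⟨⟨h1, h2⟩, h3⟩ := hi
    obtain ⟨i, rfl⟩ := Nat.exists_eq_add_of_le' h1
    exact ⟨i, by simpa using ⟨h2, (isPal_factor h2).1 h3⟩, rfl⟩

/-- A palindromic suffix here starts with `a`, hence at the start of an image, so it is `σ(w)a` with
`w` a palindromic suffix of `pre n`. The extra 1 is the empty `w`. -/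
theorem A_sigmaLen_add_one (n : ℕ) : A (sigmaLen n + 1) = A n + 1 := by
  classical
  have h : A n + 1 = ((Finset.range (n + 1)).filter (fun i => PalOn i n)).card := by
    rw [Finset.range_add_one, Finset.filter_insert, if_pos (palOn_self n),
      Finset.card_insert_of_notMem (by simp), A_eq_card]
  rw [h, A_eq_card]
  symm
  refine Finset.card_bij (fun i _ => sigmaLen i) ?_ ?_ ?_
  · intro i hi
    simp only [Finset.mem_filter, Finset.mem_range, Nat.lt_succ_iff] at hi ⊢
    exact ⟨sigmaLen_strictMono.monotone hi.1, (palOn_sigmaLen_of_le hi.1).2 hi.2⟩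
  · intro i _ j _ h; exact sigmaLen_strictMono.injective h
  · intro k hk
    simp only [Finset.mem_filter, Finset.mem_range, Nat.lt_succ_iff] at hk
    have hka := ((palOn_succ hk.1).1 hk.2).1
    rw [fibSeq_sigmaLen] at hka
    rcases exists_eq_sigmaLen k with ⟨i, rfl⟩ | ⟨i, hi, rfl⟩
    · have hin : i ≤ n := sigmaLen_strictMono.le_iff_le.1 hk.1
      refine ⟨i, ?_, rfl⟩
      simp only [Finset.mem_filter, Finset.mem_range, Nat.lt_succ_iff]
      exact ⟨hin, (palOn_sigmaLen_of_le hin).1 hk.2⟩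
    · rw [fibSeq_sigmaLen_add_one hi] at hka; cases hka

/-- These suffixes start and end with `b`; adding the `a` on each side gives `σ(w)a` with `w` a
nonempty palindrome ending in the letter at `n`. -/
theorem A_sigmaLen_add_two {n : ℕ} (hn : fibSeq n = Letter.a) :
    A (sigmaLen n + 2) = A (n + 1) := by
  classical
  have key : ∀ i, i ≤ n → (PalOn (sigmaLen i + 1) (sigmaLen n + 2) ↔ PalOn i (n + 1)) := by
    intro i hi
    have := sigmaLen_strictMono.monotone hi
    rw [← palOn_sigmaLen_of_le (i := i) (j := n + 1) (by omega), sigmaLen_succ_of_a hn,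
      palOn_succ (i := sigmaLen i) (by omega),
      ← sigmaLen_succ_of_a hn, fibSeq_sigmaLen, fibSeq_sigmaLen]
    simp
  rw [A_eq_card, A_eq_card]
  symm
  refine Finset.card_bij (fun i _ => sigmaLen i + 1) ?_ ?_ ?_
  · intro i hi
    simp only [Finset.mem_filter, Finset.mem_range, Nat.lt_succ_iff] at hi ⊢
    have := sigmaLen_strictMono.monotone hi.1
    exact ⟨by omega, (key i hi.1).2 hi.2⟩
  · intro i _ j _ h; exact sigmaLen_strictMono.injective (by simpa using h)
  · intro k hk
    simp only [Finset.mem_filter, Finset.mem_range, Nat.lt_succ_iff] at hk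
    have hkb := ((palOn_succ (j := sigmaLen n + 1) (by omega)).1 hk.2).1
    rw [fibSeq_sigmaLen_add_one hn] at hkb
    rcases exists_eq_sigmaLen k with ⟨i, rfl⟩ | ⟨i, hi, rfl⟩
    · rw [fibSeq_sigmaLen] at hkb; cases hkb
    · have hin : i ≤ n := sigmaLen_strictMono.le_iff_le.1 (by omega)
      refine ⟨i, ?_, rfl⟩
      simp only [Finset.mem_filter, Finset.mem_range, Nat.lt_succ_iff]
      exact ⟨hin, (key i hin).1 hk.2⟩

/-! ### Summation over prefixes -/

theorem B_succ (n : ℕ) : B (n + 1) = B n + A (n + 1) :=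
  Finset.sum_Icc_succ_top (by omega) _

/-- The number of occurrences of palindromes in the prefix of length `n` that end with `a`. -/
def palEndingInA (n : ℕ) : ℕ :=
  ∑ i ∈ Finset.range n, if fibSeq i = Letter.a then A (i + 1) else 0

theorem palEndingInA_succ (n : ℕ) :
    palEndingInA (n + 1) = palEndingInA n + if fibSeq n = Letter.a then A (n + 1) else 0 :=
  Finset.sum_range_succ _ _

theorem palEndingInA_sigmaLen_succ (n : ℕ) :
    palEndingInA (sigmaLen (n + 1)) = palEndingInA (sigmaLen n) + (A n + 1) := by
  rcases Letter.eq_a_or_eq_b (fibSeq n) with hn | hn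
  · rw [sigmaLen_succ_of_a hn, palEndingInA_succ, palEndingInA_succ, fibSeq_sigmaLen_add_one hn,
      fibSeq_sigmaLen, A_sigmaLen_add_one]
    simp
  · rw [sigmaLen_succ_of_b hn, palEndingInA_succ, fibSeq_sigmaLen, A_sigmaLen_add_one]
    simp

/-- Every image contains exactly one `a`, its first letter, so the sum is that of `A j + 1` over `j
< n`; it stops short of `A n`. -/
theorem palEndingInA_sigmaLen (n : ℕ) : palEndingInA (sigmaLen n) + A n = B n + n := by
  induction n with
  | zero => rfl
  | succ n ih => rw [palEndingInA_sigmaLen_succ, B_succ]; omega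

/-- The second summand counts palindromes ending in `b`: each such `b` closes the image of an `a`,
with the same value of `A`. -/
theorem B_sigmaLen (n : ℕ) :
    B (sigmaLen n) = palEndingInA (sigmaLen n) + palEndingInA n := by
  induction n with
  | zero => rfl
  | succ n ih =>
    rw [palEndingInA_sigmaLen_succ, palEndingInA_succ]
    rcases Letter.eq_a_or_eq_b (fibSeq n) with hn | hn
    · rw [sigmaLen_succ_of_a hn, B_succ, B_succ, A_sigmaLen_add_one, A_sigmaLen_add_two hn,
        if_pos hn]
      omega
    · rw [sigmaLen_succ_of_b hn, B_succ, A_sigmaLen_add_one, hn]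
      simp; omega

/-! ### Prefixes of Fibonacci length -/

theorem length_F (m : ℕ) : (F m).length = f m := by
  induction m using Nat.twoStepInduction with
  | zero => rfl
  | one => rfl
  | more k h1 h2 => rw [F_add_two, List.length_append, h1, h2, f]

theorem F_eq_pre (m : ℕ) : F m = pre (f m) := by
  rw [pre_eq_take (length_F m).ge, ← length_F m, List.take_length]

theorem sigmaLen_f (m : ℕ) : sigmaLen (f m) = f (m + 1) := by
  rw [sigmaLen, ← F_eq_pre, ← F_succ, length_F]

/-- The numbers of palindromic suffixes of `F_m` and of `F_m` without its last letter. -/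
theorem A_f (m : ℕ) : ∃ k, f m = k + 1 ∧ A (k + 1) = m / 2 + 1 ∧ A k = (m + 1) / 2 ∧
    (m % 2 = 0 ∧ fibSeq k = Letter.a ∨
      m % 2 = 1 ∧ fibSeq k = Letter.b ∧ ∃ l, k = l + 1 ∧ fibSeq l = Letter.a) := by
  induction m with
  | zero =>
    exact ⟨0, rfl, A_sigmaLen_add_one 0, rfl, Or.inl ⟨rfl, rfl⟩⟩
  | succ m ih =>
    obtain ⟨k, hk, h1, h0, ⟨hm, ha⟩ | ⟨hm, hb, l, rfl, hl⟩⟩ := ih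
    · refine ⟨sigmaLen k + 1, ?_, ?_, ?_,
        Or.inr ⟨by omega, fibSeq_sigmaLen_add_one ha, _, rfl, fibSeq_sigmaLen k⟩⟩
      · rw [← sigmaLen_f, hk, sigmaLen_succ_of_a ha]
      · rw [A_sigmaLen_add_two ha]; omega
      · rw [A_sigmaLen_add_one]; omega
    -- `F m` ends in `ab`, so the next word ends in `σ(ab) = aba`; the position `l` of that `a` is
    -- what evaluates `A` before the last letter.
    · refine ⟨sigmaLen (l + 1), ?_, ?_, ?_, Or.inl ⟨by omega, fibSeq_sigmaLen _⟩⟩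
      · rw [← sigmaLen_f, hk, sigmaLen_succ_of_b hb]
      · rw [A_sigmaLen_add_one]; omega
      · rw [sigmaLen_succ_of_a hl, A_sigmaLen_add_two hl]; omega

/-- The correction `m + 2` is `A (f m) + A (f (m + 1))`, since `m / 2 + (m + 1) / 2 = m`. -/
theorem B_f_add_two (m : ℕ) :
    B (f (m + 2)) + (m + 2) = B (f (m + 1)) + B (f m) + f (m + 2) := by
  have h1 := palEndingInA_sigmaLen (f m)
  have h2 := palEndingInA_sigmaLen (f (m + 1))
  have h3 := B_sigmaLen (f (m + 1))
  obtain ⟨k, hk, hA, -⟩ := A_f m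
  obtain ⟨l, hl, hA', -⟩ := A_f (m + 1)
  rw [← hk] at hA
  rw [← hl] at hA'
  rw [sigmaLen_f] at h1 h2 h3
  rw [show m + 1 + 1 = m + 2 from rfl] at h2 h3
  have hf : f (m + 2) = f (m + 1) + f m := rfl
  omega

theorem palOccurrences_pre (n : ℕ) : palOccurrences (pre n) = B n := by
  unfold palOccurrences B A
  rw [length_pre, Finset.card_eq_sum_card_fiberwise (f := Prod.snd) (t := Finset.Icc 1 n)
    (fun p hp => by simp only [Finset.coe_filter, Finset.mem_product, Set.mem_ofPred_eq] at hp
                    exact hp.1.2)]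
  refine Finset.sum_congr rfl fun j hj => ?_
  rw [Finset.mem_Icc] at hj
  refine Finset.card_bij (fun p _ => p.1) ?_ ?_ ?_
  · rintro ⟨i, j'⟩ hp
    simp only [Finset.mem_filter, Finset.mem_product, Finset.mem_Icc] at hp ⊢
    obtain ⟨⟨⟨⟨h1, -⟩, -⟩, h2, h3⟩, rfl⟩ := hp
    exact ⟨⟨h1, h2⟩, factor_pre hj.2 h1 ▸ h3⟩
  · rintro ⟨i, j'⟩ hp ⟨i', j''⟩ hp' h
    simp only [Finset.mem_filter] at hp hp'
    exact Prod.ext h (hp.2.trans hp'.2.symm)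
  · intro i hi
    simp only [Finset.mem_filter, Finset.mem_Icc] at hi
    refine ⟨(i, j), ?_, rfl⟩
    simp only [Finset.mem_filter, Finset.mem_product, Finset.mem_Icc]
    exact ⟨⟨⟨⟨hi.1.1, hi.1.2.trans hj.2⟩, hj⟩, hi.1.2, (factor_pre hj.2 hi.1.1).symm ▸ hi.2⟩, trivial⟩

theorem B_f (m : ℕ) :
    (B (f m) : ℚ) = ((m : ℚ) - 3) / 5 * (f (m + 2) : ℚ) + ((m : ℚ) - 1) / 5 * (f m : ℚ)
      + (m : ℚ) + 3 := by
  induction m using Nat.twoStepInduction with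
  | zero =>
    have h : B (f 0) = 1 := by decide
    rw [h]; norm_num [f]
  | one =>
    have h : B (f 1) = 2 := by decide
    rw [h]; norm_num [f]
  | more m h1 h2 =>
    have h : (B (f (m + 2)) : ℚ) + (m + 2) = B (f (m + 1)) + B (f m) + f (m + 2) := by
      exact_mod_cast B_f_add_two m
    have e4 : (f (m + 2 + 2) : ℚ) = f (m + 1 + 2) + f (m + 2) := by exact_mod_cast rfl
    have e3 : (f (m + 1 + 2) : ℚ) = f (m + 2) + f (m + 1) := by exact_mod_cast rfl
    have e2 : (f (m + 2) : ℚ) = f (m + 1) + f m := by exact_mod_cast rfl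
    rw [eq_sub_of_add_eq h, h1, h2, e4, e3, e2]
    push_cast
    ring

end FibPal

theorem theorem6p7 (m : ℕ) :
    FibPal.F m = FibPal.pre (FibPal.f m) ∧
    FibPal.palOccurrences (FibPal.F m) = FibPal.B (FibPal.f m) ∧
    (FibPal.B (FibPal.f m) : ℚ) =
      ((m : ℚ) - 3) / 5 * (FibPal.f (m + 2) : ℚ) + ((m : ℚ) - 1) / 5 * (FibPal.f m : ℚ)
        + (m : ℚ) + 3 :=
  ⟨FibPal.F_eq_pre m, by rw [FibPal.F_eq_pre, FibPal.palOccurrences_pre], FibPal.B_f m⟩
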